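/- **Model.** Let $G$ be a finite undirected tree in which every node has degree $1$ (a leaf) or degree at least $3$; let $L$ be its number of leaves and $|E|$ its number of edges. Each edge gives two directed links, one per direction. In an experiment every directed link $d$ works with its own probability $\alpha_d\in(0,1]$, independently of all other directed links (the two directions of an edge may have different probabilities). A *configuration* $(G,S,R)$ consists of a partition of the leaves into sources $S$ and receivers $R$ together with an orientation of every edge (the direction in which probes flow), such that edges leave the sources and enter the receivers and every intermediate node has in-degree and out-degree at least one. Its *dual* reverses all orientations and exchanges $S$ and $R$. In one experiment with network coding, the sources inject distinct unit vectors of $\mathbb F_2^{S}$; each intermediate node forwards on all its outgoing links the XOR of the packets that reach it over its working incoming links; the receivers observe the packets that reach them. The *bandwidth* of an experiment is the number of directed links into which a probe is sent when nothing is lost. A *multicast tree* is a configuration with exactly one source (all other leaves are receivers), so that no coding takes place. A *measurement plan* is a finite sequence of configurations, called rounds; it *measures all links in both directions* if, for every directed link $e$ and all $\alpha,\alpha'$ with entries in $(0,1]$, equality of the outcome distributions under $\alpha$ and $\alpha'$ in every round implies $\alpha_e=\alpha'_e$. The bandwidth of a plan is the sum of the bandwidths of its rounds (one experiment per round). **Corollary.**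 1. For every partition of the leaves into a nonempty set $S$ and a nonempty set $R$ there is a configuration with sources $S$ and receivers $R$. 2. For every configuration $c$, the two-round plan formed by $c$ and its dual measures all links in both directions. Each of its two rounds has bandwidth $|E|$, so the plan has bandwidth $2|E|$ (one probe per directed link). 3. No plan that consists of a single configuration measures all links in both directions. 4. A plan of multicast trees that measures all links in both directions contains, for every leaf $A$, a multicast tree rooted at $A$. Hence it has at least $L$ rounds; its bandwidth is at least $L$ times the bandwidth of a network coding round, and at least $L/2$ times the bandwidth of the two-round network coding plan. 5. There is a plan of $L$ multicast trees that measures all links in both directions. It has bandwidth $L\,|E|$, so both bounds in 4 are attained: network coding saves exactly a factor of $L$ in bandwidth per network coding round, that is, a factor of $L/2$ when both rounds (the configuration and its dual) are added up. -/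

import Mathlib

namespace LossTomography

variable {V : Type*} [Fintype V] [DecidableEq V]

/-- The leaves of the tree: the nodes of degree one. -/
def leaves (G : SimpleGraph V) [DecidableRel G.Adj] : Finset V :=
  Finset.univ.filter fun v => G.degree v = 1

/-- A configuration `(G, S, R)` on the undirected topology `G`. A dart of `G` is a directed link,
that is, an edge together with one of its two directions. A configuration uses every edge of `G` in
exactly one direction; every leaf is either a source or a receiver; probes leave the sources
and enter the receivers; an intermediate node has in-degree and out-degree at least one. -/
structure Configuration (G : SimpleGraph V) [DecidableRel G.Adj] where
  /-- the directed links along which probes flow -/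
  links : Finset G.Dart
  sources : Finset V
  receivers : Finset V
  mem_links_iff : ∀ d : G.Dart, d ∈ links ↔ d.symm ∉ links
  disjoint : Disjoint sources receivers
  union_eq : sources ∪ receivers = leaves G
  source_no_in : ∀ d ∈ links, d.snd ∉ sources
  receiver_no_out : ∀ d ∈ links, d.fst ∉ receivers
  exists_in : ∀ v, v ∉ leaves G → ∃ d ∈ links, d.snd = v
  exists_out : ∀ v, v ∉ leaves G → ∃ d ∈ links, d.fst = v

namespace Configuration

variable {G : SimpleGraph V} [DecidableRel G.Adj]

/-- The dual configuration: all links are reversed, sources and receivers exchange their roles. -/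
def dual (c : Configuration G) : Configuration G where
  links := Finset.univ.filter fun d => d.symm ∈ c.links
  sources := c.receivers
  receivers := c.sources
  mem_links_iff d := by
    have h := c.mem_links_iff d.symm
    simpa using h
  disjoint := c.disjoint.symm
  union_eq := by rw [Finset.union_comm]; exact c.union_eq
  source_no_in d hd := c.receiver_no_out d.symm (by simpa using hd)
  receiver_no_out d hd := c.source_no_in d.symm (by simpa using hd)
  exists_in v hv := by
    obtain ⟨d, hd, rfl⟩ := c.exists_out v hv
    exact ⟨d.symm, by simpa using hd, rfl⟩
  exists_out v hv := by
    obtain ⟨d, hd, rfl⟩ := c.exists_in v hv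
    exact ⟨d.symm, by simpa using hd, rfl⟩

/-- A probe packet: a binary vector with one coordinate per source. -/
abbrev Packet (c : Configuration G) : Type _ := {s : V // s ∈ c.sources} → ZMod 2

/-- The packet injected at `v`: the unit vector of `v` if `v` is a source, and nothing otherwise. -/
def injected (c : Configuration G) (v : V) : c.Packet :=
  if h : v ∈ c.sources then Pi.single ⟨v, h⟩ 1 else 0

/-- The node operation. `ω d = true` means that the directed link `d` works in the experiment at
hand. A node holds the packet injected at it, XORed with all the packets that reach it over its
working incoming links; it sends the packet it holds over all its outgoing links. -/
def nodeOperation (c : Configuration G) (ω : G.Dart → Bool) (X : V → c.Packet) : V → c.Packet :=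
  fun v => c.injected v + ∑ d ∈ c.links.filter fun d => d.snd = v ∧ ω d = true, X d.fst

/-- The packets held by the nodes at the end of an experiment with link states `ω`. A directed path
has fewer than `|V|` links, so the node operations have settled after `|V|` steps
(see `packet_eq`). -/
def packet (c : Configuration G) (ω : G.Dart → Bool) : V → c.Packet :=
  (c.nodeOperation ω)^[Fintype.card V] 0

/-- The directed links of a configuration on a tree contain no directed cycle. -/
theorem acyclic (hG : G.IsTree) (c : Configuration G) (v : V) :
    ¬ Relation.TransGen (fun a b => ∃ d ∈ c.links, d.fst = a ∧ d.snd = b) v v := by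
  intro h
  obtain ⟨w, ⟨d, hd, rfl, rfl⟩, hw⟩ := Relation.TransGen.head'_iff.1 h
  have hb : ¬ (G.deleteEdges {s(d.fst, d.snd)}).Reachable d.fst d.snd :=
    SimpleGraph.isBridge_iff.1 (SimpleGraph.isAcyclic_iff_forall_adj_isBridge.1 hG.isAcyclic d.adj)
  refine hb (SimpleGraph.Reachable.symm ?_)
  refine Relation.ReflTransGen.rec
    (motive := fun z _ => (G.deleteEdges {s(d.fst, d.snd)}).Reachable d.snd z) ?_ ?_ hw
  · exact SimpleGraph.Reachable.refl _
  · rintro a b - ⟨f, hf, rfl, rfl⟩ ih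
    by_cases he : s(f.fst, f.snd) = s(d.fst, d.snd)
    · rcases Sym2.eq_iff.1 he with ⟨-, h2⟩ | ⟨h1, h2⟩
      · rw [h2]
      · have hfd : f = d.symm := by
          ext
          · exact h1
          · exact h2
        exact absurd (hfd ▸ hf) ((c.mem_links_iff d).1 hd)
    · refine ih.trans (SimpleGraph.Adj.reachable ?_)
      rw [SimpleGraph.deleteEdges_adj]
      exact ⟨f.adj, by simpa using he⟩

/-- On a tree, the packets of an experiment satisfy the node equations: every node holds the packet
injected at it, XORed with the packets of the nodes from which it has a working incoming link. -/
theorem packet_eq (hG : G.IsTree) (c : Configuration G) (ω : G.Dart → Bool) (v : V) :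
    c.packet ω v =
      c.injected v + ∑ d ∈ c.links.filter fun d => d.snd = v ∧ ω d = true, c.packet ω d.fst := by
  classical
  let anc : V → Finset V := fun v => Finset.univ.filter fun u =>
    Relation.TransGen (fun a b => ∃ d ∈ c.links, d.fst = a ∧ d.snd = b) u v
  have hlt : ∀ d ∈ c.links, (anc d.fst).card < (anc d.snd).card := fun d hd => by
    refine Finset.card_lt_card ⟨fun u hu => ?_, fun h => ?_⟩
    · simp only [anc, Finset.mem_filter, Finset.mem_univ, true_and] at hu ⊢
      exact hu.tail ⟨d, hd, rfl, rfl⟩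
    · have : d.fst ∈ anc d.fst := h (by
        simp only [anc, Finset.mem_filter, Finset.mem_univ, true_and]
        exact Relation.TransGen.single ⟨d, hd, rfl, rfl⟩)
      simp only [anc, Finset.mem_filter, Finset.mem_univ, true_and] at this
      exact c.acyclic hG _ this
  have key : ∀ n v, (anc v).card < n →
      (c.nodeOperation ω)^[n] 0 v = (c.nodeOperation ω)^[n + 1] 0 v := by
    intro n
    induction n with
    | zero => intro v h; exact absurd h (Nat.not_lt_zero _)
    | succ n ih =>
      intro v h
      rw [Function.iterate_succ_apply', Function.iterate_succ_apply' _ (n + 1)]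
      unfold nodeOperation
      congr 1
      refine Finset.sum_congr rfl fun d hd => ?_
      rw [Finset.mem_filter] at hd
      have := hlt d hd.1
      rw [hd.2.1] at this
      exact ih d.fst (by omega)
  have hcard : (anc v).card < Fintype.card V := by
    refine Finset.card_lt_univ_of_notMem (x := v) fun h => ?_
    simp only [anc, Finset.mem_filter, Finset.mem_univ, true_and] at h
    exact c.acyclic hG _ h
  have h := key _ v hcard
  rw [Function.iterate_succ_apply'] at h
  exact h

/-- The outcome of one experiment: the packets collected by the receivers. -/
abbrev Outcome (c : Configuration G) : Type _ := {r : V // r ∈ c.receivers} → c.Packet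

/-- The outcome when the link states are `ω`. -/
def outcome (c : Configuration G) (ω : G.Dart → Bool) : c.Outcome := fun r => c.packet ω r

/-- The probability mass function `p(x; α)` of the outcome of one experiment, when the directed
links work independently of each other, link `d` with probability `α d`. The two directions of an
edge have separate success probabilities. -/
def pmf (c : Configuration G) (α : G.Dart → ℝ) (x : c.Outcome) : ℝ :=
  ∑ ω : G.Dart → Bool,
    if c.outcome ω = x then ∏ d, (if ω d = true then α d else 1 - α d) else 0

/-- The probe bandwidth of one experiment: the number of directed links into which a probe packet
is sent when no packet is lost. -/
def bandwidth (c : Configuration G) : ℕ :=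
  (c.links.filter fun d => c.packet (fun _ => true) d.fst ≠ 0).card

/-- A multicast tree: a configuration with a single source; all the other leaves are receivers. -/
def IsMulticastTree (c : Configuration G) : Prop := c.sources.card = 1

end Configuration

variable {G : SimpleGraph V} [DecidableRel G.Adj]

/-- A measurement plan is a finite sequence of rounds; round `i` consists of independent
experiments with configuration `T i`. The plan identifies the directed link `e` if the outcome
distributions of its rounds determine the success probability of `e`, among all the vectors of
success probabilities in `(0, 1]`. -/
def Identifies {k : ℕ} (T : Fin k → Configuration G) (e : G.Dart) : Prop :=
  ∀ α α' : G.Dart → ℝ, (∀ d, 0 < α d ∧ α d ≤ 1) → (∀ d, 0 < α' d ∧ α' d ≤ 1) →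
    (∀ i, (T i).pmf α = (T i).pmf α') → α e = α' e

/-- The plan measures all the links of the tree in both directions. -/
def MeasuresBothDirections {k : ℕ} (T : Fin k → Configuration G) : Prop :=
  ∀ e : G.Dart, Identifies T e

/-- The total bandwidth of a plan, for one experiment in each round. -/
def planBandwidth {k : ℕ} (T : Fin k → Configuration G) : ℕ := ∑ i, (T i).bandwidth

end LossTomography

/-!
Link losses are independent, so the probability that all links of a set `U` work is `∏ d ∈ U, α d`.
On a tree the packet at a receiver `r` has a nonzero coordinate at a source `s` exactly when every
link of the directed path from `s` to `r` works. Hence the outcome distribution determines the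
products of `α` over unions of source-receiver paths. At an intermediate node three paths
meet; two of their pairwise concatenations are source-receiver paths, with links `X ∪ Y` and
`X ∪ Z`, and the products over these two sets and their union yield the products over `X`, `Y` and
`Z`. Cancelling the products before and after a link isolates its success probability. Conversely,
the outcome ignores the links that a configuration does not use. So a plan identifies exactly the
links that it uses, and the claims about plans become statements about orientations of the tree.
-/

namespace LossTomography

open SimpleGraph Finset

section ProdEqOn

variable {ι M : Type*} [CommMonoidWithZero M] {f g : ι → M} {s t u : Finset ι}

/-- The functions `f` and `g` have the same product over `s`. For two vectors of success
probabilities this says that the links in `s` have the same probability of all working. -/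
def ProdEqOn (f g : ι → M) (s : Finset ι) : Prop := ∏ i ∈ s, f i = ∏ i ∈ s, g i

theorem prodEqOn_empty : ProdEqOn f g ∅ := by simp [ProdEqOn]

variable [DecidableEq ι] [IsCancelMulZero M] [Nontrivial M]

theorem ProdEqOn.right_of_union (hg : ∀ i, g i ≠ 0) (hst : Disjoint s t)
    (h : ProdEqOn f g (s ∪ t)) (hs : ProdEqOn f g s) : ProdEqOn f g t := by
  have : NoZeroDivisors M := IsLeftCancelMulZero.to_noZeroDivisors M
  rw [ProdEqOn] at hs
  rw [ProdEqOn, prod_union hst, prod_union hst, hs] at h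
  exact mul_left_cancel₀ (prod_ne_zero_iff.2 fun i _ => hg i) h

theorem ProdEqOn.left_of_union (hg : ∀ i, g i ≠ 0) (hst : Disjoint s t)
    (h : ProdEqOn f g (s ∪ t)) (ht : ProdEqOn f g t) : ProdEqOn f g s :=
  (union_comm s t ▸ h).right_of_union hg hst.symm ht

theorem ProdEqOn.of_union_union (hg : ∀ i, g i ≠ 0) (hst : Disjoint s t) (hsu : Disjoint s u)
    (htu : Disjoint t u) (h : ProdEqOn f g (s ∪ t)) (h' : ProdEqOn f g (s ∪ u))
    (h'' : ProdEqOn f g ((s ∪ t) ∪ (s ∪ u))) : ProdEqOn f g s ∧ ProdEqOn f g t := by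
  rw [← union_union_distrib_left, ← union_assoc] at h''
  have hu := h''.right_of_union hg (disjoint_union_left.2 ⟨hsu, htu⟩) h
  have hs := h'.left_of_union hg hsu hu
  exact ⟨hs, h.right_of_union hg hst hs⟩

end ProdEqOn

section Bernoulli

variable {ι R : Type*} [Fintype ι] [CommRing R]

/-- The probability of `ω` when the coordinates are independent and coordinate `i` is `true` with
probability `α i`. -/
def bernoulliWeight (α : ι → R) (ω : ι → Bool) : R := ∏ i, if ω i = true then α i else 1 - α i

variable [DecidableEq ι]

theorem sum_bernoulliWeight_of_forall_mem (α : ι → R) (U : Finset ι) :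
    ∑ ω with ∀ i ∈ U, ω i = true, bernoulliWeight α ω = ∏ i ∈ U, α i := by
  have hU : ({ω | ∀ i ∈ U, ω i = true} : Finset (ι → Bool)) =
      Fintype.piFinset fun i => if i ∈ U then {true} else univ := by
    ext ω
    simp only [mem_filter, mem_univ, true_and, Fintype.mem_piFinset]
    refine forall_congr' fun i => ?_
    split_ifs with hi <;> simp [hi]
  have hfactor (i : ι) : ∑ b ∈ if i ∈ U then {true} else univ,
      (if b = true then α i else 1 - α i) = if i ∈ U then α i else 1 := by
    split_ifs <;> simp
  rw [hU]
  simp only [bernoulliWeight]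
  rw [← prod_univ_sum _ fun i b => if b = true then α i else 1 - α i,
    prod_congr rfl fun i _ => hfactor i, prod_ite_mem, univ_inter]

theorem bernoulliWeight_add_bernoulliWeight_flip (α : ι → R) (ω : ι → Bool) (e : ι) :
    bernoulliWeight α ω + bernoulliWeight α (Function.update ω e (!ω e)) =
      ∏ i ∈ univ.erase e, if ω i = true then α i else 1 - α i := by
  have hflip : ∏ i ∈ univ.erase e,
      (if Function.update ω e (!ω e) i = true then α i else 1 - α i) =
        ∏ i ∈ univ.erase e, if ω i = true then α i else 1 - α i :=
    prod_congr rfl fun i hi => by rw [Function.update_of_ne (ne_of_mem_erase hi)]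
  rw [bernoulliWeight, bernoulliWeight, ← mul_prod_erase _ _ (mem_univ e),
    ← mul_prod_erase _ _ (mem_univ e), hflip, ← add_mul, Function.update_self]
  cases ω e <;> simp

theorem sum_bernoulliWeight_update {P : (ι → Bool) → Prop} [DecidablePred P] {e : ι}
    (hP : ∀ ω b, P (Function.update ω e b) ↔ P ω) (α : ι → R) (t : R) :
    ∑ ω with P ω, bernoulliWeight (Function.update α e t) ω =
      ∑ ω with P ω, bernoulliWeight α ω := by
  have hoff (ω : ι → Bool) :
      ∏ i ∈ univ.erase e, (if ω i = true then Function.update α e t i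
        else 1 - Function.update α e t i) =
      ∏ i ∈ univ.erase e, if ω i = true then α i else 1 - α i :=
    prod_congr rfl fun i hi => by rw [Function.update_of_ne (ne_of_mem_erase hi)]
  rw [← sub_eq_zero, ← sum_sub_distrib]
  -- Flipping the coordinate `e` pairs off the states, and the total weight of a pair is
  -- independent of `α e`.
  refine sum_involution (fun ω _ => Function.update ω e (!ω e)) (fun ω _ => ?_) (fun ω _ _ h => ?_)
    (fun ω hω => ?_) fun ω _ => by simp
  · rw [sub_add_sub_comm, bernoulliWeight_add_bernoulliWeight_flip,
      bernoulliWeight_add_bernoulliWeight_flip, hoff, sub_self]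
  · simpa using congrFun h e
  · simpa [hP] using hω

end Bernoulli

section Toward

variable {V : Type*} {G : SimpleGraph V} {d : G.Dart} {u u' v v' w w' x : V}

/-- The directed link `d` leads towards `x`: in a tree, it is the first link of the path from its
tail to `x` (see `toward_iff_exists_isPath`). -/
def Toward (d : G.Dart) (x : V) : Prop := G.dist x d.snd < G.dist x d.fst

theorem not_toward_fst (d : G.Dart) : ¬ Toward d d.fst := by simp [Toward]

theorem toward_symm (hG : G.IsTree) : Toward d.symm x ↔ ¬ Toward d x :=
  ⟨fun h => not_lt_of_gt h, fun h => (not_lt.1 h).lt_of_ne (hG.dist_ne_of_adj x d.adj)⟩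

theorem walk_eq_of_isPath (hG : G.IsAcyclic) {u v : V} {p q : G.Walk u v} (hp : p.IsPath)
    (hq : q.IsPath) : p = q :=
  congrArg Subtype.val ((hG.subsingleton_path u v).elim ⟨p, hp⟩ ⟨q, hq⟩)

theorem toward_iff_exists_isPath (hG : G.IsTree) :
    Toward d x ↔ ∃ p : G.Walk d.snd x, (Walk.cons d.adj p).IsPath := by
  rw [Toward, dist_comm (u := x), dist_comm (u := x)]
  constructor
  · intro hlt
    obtain ⟨p, hp⟩ := hG.connected.exists_walk_length_eq_dist d.snd x
    refine ⟨p, Walk.isPath_of_length_eq_dist _ (le_antisymm ?_ (dist_le _))⟩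
    rw [Walk.length_cons, hp]
    exact hlt
  · rintro ⟨p, hp⟩
    obtain ⟨q, hq, hlen⟩ := hG.connected.exists_path_of_dist d.fst x
    rw [← hlen, ← walk_eq_of_isPath hG.isAcyclic hp hq, Walk.length_cons]
    exact Nat.lt_succ_of_le (dist_le p)

theorem existsUnique_toward (hG : G.IsTree) (hvx : v ≠ x) :
    ∃! d : G.Dart, d.fst = v ∧ Toward d x := by
  obtain ⟨p, hp, -⟩ := hG.existsUnique_path v x
  cases p with
  | nil => exact absurd rfl hvx
  | cons h p =>
    refine ⟨⟨(v, _), h⟩, ⟨rfl, (toward_iff_exists_isPath hG).2 ⟨p, hp⟩⟩, ?_⟩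
    rintro d ⟨rfl, hd⟩
    obtain ⟨q, hq⟩ := (toward_iff_exists_isPath hG).1 hd
    have hdarts := congrArg Walk.darts (walk_eq_of_isPath hG.isAcyclic hq hp)
    exact (List.cons.inj hdarts).1

theorem toward_of_isPath_cons (hG : G.IsTree) {h : G.Adj u v} {p : G.Walk v w}
    (hp : (Walk.cons h p).IsPath) (hx : x ∈ p.support) : Toward ⟨(u, v), h⟩ x := by
  classical
  refine (toward_iff_exists_isPath hG).2 ⟨p.takeUntil x hx, ?_⟩
  rw [Walk.cons_isPath_iff] at hp ⊢
  exact ⟨hp.1.takeUntil hx, fun hu => hp.2 (p.support_takeUntil_subset_support hx hu)⟩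

theorem disjoint_darts_of_isPath_append {p : G.Walk u v} {q : G.Walk v w}
    (hpq : (p.append q).IsPath) : p.darts.Disjoint q.darts := by
  have hnodup := Walk.darts_nodup_of_support_nodup hpq.support_nodup
  rw [Walk.darts_append, List.nodup_append'] at hnodup
  exact hnodup.2.2

theorem disjoint_darts_cons (hG : G.IsTree) {h : G.Adj u v} {h' : G.Adj u v'} {p : G.Walk v w}
    {p' : G.Walk v' w'} (hp : (Walk.cons h p).IsPath) (hp' : (Walk.cons h' p').IsPath)
    (hne : v ≠ v') : (Walk.cons h p).darts.Disjoint (Walk.cons h' p').darts := by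
  intro d hd hd'
  have hx : d.snd ∈ p.support := by
    simpa [Walk.map_snd_darts] using List.mem_map_of_mem (f := (·.snd)) hd
  have hx' : d.snd ∈ p'.support := by
    simpa [Walk.map_snd_darts] using List.mem_map_of_mem (f := (·.snd)) hd'
  have hu : u ≠ d.snd := fun hu => ((Walk.cons_isPath_iff h p).1 hp).2 (hu ▸ hx)
  exact hne (congrArg (·.snd) ((existsUnique_toward hG hu).unique
    ⟨rfl, toward_of_isPath_cons hG hp hx⟩ ⟨rfl, toward_of_isPath_cons hG hp' hx'⟩))

theorem disjoint_darts_concat (hG : G.IsTree) {h : G.Adj v w} {h' : G.Adj v' w} {p : G.Walk u v}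
    {p' : G.Walk u' v'} (hp : (p.concat h).IsPath) (hp' : (p'.concat h').IsPath) (hne : v ≠ v') :
    (p.concat h).darts.Disjoint (p'.concat h').darts := by
  have hrev := hp.reverse
  have hrev' := hp'.reverse
  rw [Walk.reverse_concat] at hrev hrev'
  have hdisj := disjoint_darts_cons hG hrev hrev' hne
  rw [← Walk.reverse_concat, ← Walk.reverse_concat] at hdisj
  exact fun d hd hd' => hdisj (a := d.symm)
    (Walk.mem_darts_reverse.2 (by rwa [d.symm_symm]))
    (Walk.mem_darts_reverse.2 (by rwa [d.symm_symm]))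

variable [G.LocallyFinite]

theorem toward_of_degree_fst_eq_one (hG : G.IsTree) (hd : G.degree d.fst = 1)
    (hx : d.fst ≠ x) : Toward d x := by
  obtain ⟨e, ⟨he, htoward⟩, -⟩ := existsUnique_toward hG hx
  have hsnd : e.snd = d.snd :=
    (degree_eq_one_iff_existsUnique_adj.1 hd).unique (he ▸ e.adj) d.adj
  rwa [show d = e from Dart.ext _ _ (Prod.ext he.symm hsnd.symm)]

theorem not_toward_of_degree_snd_eq_one (hG : G.IsTree) (hd : G.degree d.snd = 1)
    (hx : d.snd ≠ x) : ¬ Toward d x :=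
  (toward_symm hG).1 (toward_of_degree_fst_eq_one (d := d.symm) hG hd hx)

end Toward

theorem mem_leaves {V : Type*} [Fintype V] {G : SimpleGraph V} [DecidableRel G.Adj] {v : V} :
    v ∈ leaves G ↔ G.degree v = 1 := by
  simp [leaves]

namespace Configuration

variable {V : Type*} [Fintype V] [DecidableEq V] {G : SimpleGraph V} [DecidableRel G.Adj]
  {c : Configuration G} {u v w x y : V}

section DirectedWalk

theorem mem_dual_links {d : G.Dart} : d ∈ c.dual.links ↔ d.symm ∈ c.links := by
  simp [dual]

theorem mem_links_or_symm_mem_links (c : Configuration G) (d : G.Dart) :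
    d ∈ c.links ∨ d.symm ∈ c.links := by
  rw [c.mem_links_iff d]
  exact (em _).symm

/-- A probe can move from `a` to `b` over a single link of the configuration. -/
def Flow (c : Configuration G) (a b : V) : Prop := ∃ d ∈ c.links, d.fst = a ∧ d.snd = b

/-- The walk `p` uses only links of the configuration, so it follows the flow of the probes. -/
def IsDirected (c : Configuration G) (p : G.Walk u v) : Prop := ∀ d ∈ p.darts, d ∈ c.links

theorem isDirected_nil : c.IsDirected (Walk.nil : G.Walk u u) := by
  simp [IsDirected]

theorem isDirected_cons {h : G.Adj u v} {p : G.Walk v w} :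
    c.IsDirected (.cons h p) ↔ ⟨(u, v), h⟩ ∈ c.links ∧ c.IsDirected p := by
  simp [IsDirected]

theorem isDirected_append {p : G.Walk u v} {q : G.Walk v w} :
    c.IsDirected (p.append q) ↔ c.IsDirected p ∧ c.IsDirected q := by
  simp only [IsDirected, Walk.darts_append, List.mem_append, or_imp, forall_and]

theorem isDirected_concat {p : G.Walk u v} {h : G.Adj v w} :
    c.IsDirected (p.concat h) ↔ c.IsDirected p ∧ ⟨(v, w), h⟩ ∈ c.links := by
  rw [Walk.concat_eq_append, isDirected_append, isDirected_cons, and_iff_left isDirected_nil]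

theorem isDirected_reverse {p : G.Walk u v} : c.dual.IsDirected p.reverse ↔ c.IsDirected p := by
  simp only [IsDirected, Walk.mem_darts_reverse, mem_dual_links]
  exact Dart.symm_involutive.surjective.forall (p := fun d => d ∈ p.darts → d ∈ c.links) |>.symm

theorem IsDirected.reflTransGen_flow {p : G.Walk u v} (hp : c.IsDirected p) :
    Relation.ReflTransGen c.Flow u v := by
  induction p with
  | nil => exact .refl
  | cons h p ih =>
    obtain ⟨hlink, hp⟩ := isDirected_cons.1 hp
    exact .head ⟨_, hlink, rfl, rfl⟩ (ih hp)

theorem IsDirected.isPath (hG : G.IsTree) {p : G.Walk u v} (hp : c.IsDirected p) : p.IsPath := by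
  induction p with
  | nil => exact .nil
  | @cons u v w h p ih =>
    obtain ⟨hlink, hp⟩ := isDirected_cons.1 hp
    refine (Walk.cons_isPath_iff h p).2 ⟨ih hp, fun hu => c.acyclic hG u ?_⟩
    have hback : c.IsDirected (p.takeUntil u hu) :=
      fun d hd => hp d (p.darts_takeUntil_subset_darts hu hd)
    exact .head' ⟨_, hlink, rfl, rfl⟩ hback.reflTransGen_flow

theorem IsDirected.eq (hG : G.IsTree) {p q : G.Walk u v} (hp : c.IsDirected p)
    (hq : c.IsDirected q) : p = q :=
  walk_eq_of_isPath hG.isAcyclic (hp.isPath hG) (hq.isPath hG)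

theorem wellFounded_flow (hG : G.IsTree) (c : Configuration G) : WellFounded c.Flow := by
  have : IsTrans V (Relation.TransGen c.Flow) := ⟨fun _ _ _ => Relation.TransGen.trans⟩
  have : Std.Irrefl (Relation.TransGen c.Flow) := ⟨c.acyclic hG⟩
  exact Subrelation.wf Relation.TransGen.single
    (Finite.wellFounded_of_trans_of_irrefl (Relation.TransGen c.Flow))

theorem degree_pos (c : Configuration G) (v : V) : 0 < G.degree v := by
  by_cases hv : v ∈ leaves G
  · exact (mem_leaves.1 hv).symm ▸ one_pos
  · obtain ⟨d, -, rfl⟩ := c.exists_in v hv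
    exact d.adj.degree_pos_right

theorem mem_sources_or_exists_in (c : Configuration G) (v : V) :
    v ∈ c.sources ∨ ∃ d ∈ c.links, d.snd = v := by
  by_cases hv : v ∈ leaves G
  · rw [← c.union_eq, mem_union] at hv
    refine hv.imp_right fun hr => ?_
    obtain ⟨w, hw⟩ := (G.degree_pos_iff_exists_adj v).1 (c.degree_pos v)
    refine ⟨⟨(w, v), hw.symm⟩, (c.mem_links_or_symm_mem_links _).resolve_right fun h => ?_, rfl⟩
    exact c.receiver_no_out _ h hr
  · exact .inr (c.exists_in v hv)

theorem exists_isDirected_from_source (hG : G.IsTree) (c : Configuration G) (v : V) :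
    ∃ s ∈ c.sources, ∃ p : G.Walk s v, c.IsDirected p := by
  induction v using (c.wellFounded_flow hG).induction with
  | h v ih =>
    rcases c.mem_sources_or_exists_in v with hv | ⟨d, hd, rfl⟩
    · exact ⟨v, hv, .nil, isDirected_nil⟩
    · obtain ⟨s, hs, p, hp⟩ := ih d.fst ⟨d, hd, rfl, rfl⟩
      exact ⟨s, hs, p.concat d.adj, isDirected_concat.2 ⟨hp, hd⟩⟩

theorem exists_isDirected_to_receiver (hG : G.IsTree) (c : Configuration G) (v : V) :
    ∃ r ∈ c.receivers, ∃ p : G.Walk v r, c.IsDirected p := by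
  obtain ⟨r, hr, p, hp⟩ := exists_isDirected_from_source hG c.dual v
  exact ⟨r, hr, p.reverse, isDirected_reverse.1 (p.reverse_reverse.symm ▸ hp)⟩

end DirectedWalk

section Packet

/-- In an experiment with link states `ω`, the probe injected at `u` reaches `v`: all the links of
a directed walk from `u` to `v` work. -/
def Delivers (c : Configuration G) (ω : G.Dart → Bool) (u v : V) : Prop :=
  ∃ p : G.Walk u v, c.IsDirected p ∧ ∀ d ∈ p.darts, ω d = true

variable {ω : G.Dart → Bool}

theorem IsDirected.delivers_iff (hG : G.IsTree) {p : G.Walk u v} (hp : c.IsDirected p) :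
    c.Delivers ω u v ↔ ∀ d ∈ p.darts, ω d = true :=
  ⟨fun ⟨_, hq, hω⟩ => hq.eq hG hp ▸ hω, fun hω => ⟨p, hp, hω⟩⟩

theorem delivers_self : c.Delivers ω u u := ⟨.nil, isDirected_nil, by simp⟩

theorem delivers_iff_exists_last (hne : v ≠ u) :
    c.Delivers ω u v ↔
      ∃ d ∈ c.links.filter fun d => d.snd = v ∧ ω d = true, c.Delivers ω u d.fst := by
  constructor
  · rintro ⟨_ | ⟨h, p⟩, hp, hω⟩
    · exact absurd rfl hne
    obtain ⟨x, q, hx, heq⟩ := Walk.exists_cons_eq_concat h p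
    rw [heq] at hp hω
    obtain ⟨hq, hlink⟩ := isDirected_concat.1 hp
    simp only [Walk.darts_concat, List.concat_eq_append, List.mem_append, List.mem_singleton]
      at hω
    exact ⟨_, mem_filter.2 ⟨hlink, rfl, hω _ (.inr rfl)⟩, q, hq, fun d hd => hω d (.inl hd)⟩
  · rintro ⟨d, hd, p, hp, hω⟩
    obtain ⟨hlink, rfl, hωd⟩ := mem_filter.1 hd
    refine ⟨p.concat d.adj, isDirected_concat.2 ⟨hp, hlink⟩, ?_⟩
    simp only [Walk.darts_concat, List.concat_eq_append, List.mem_append, List.mem_singleton]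
    rintro e (he | rfl)
    exacts [hω e he, hωd]

theorem eq_of_isDirected_fst (hG : G.IsTree) {d e : G.Dart} (hd : d ∈ c.links)
    (he : e ∈ c.links) (hde : d.snd = e.snd) {p : G.Walk u d.fst} {q : G.Walk u e.fst}
    (hp : c.IsDirected p) (hq : c.IsDirected q) : d = e := by
  obtain ⟨⟨x, v⟩, hd'⟩ := d
  obtain ⟨⟨y, w⟩, he'⟩ := e
  obtain rfl : v = w := hde
  have hconcat := (isDirected_concat.2 ⟨hp, hd⟩).eq hG (isDirected_concat.2 ⟨hq, he⟩)
  exact Dart.ext _ _ (Prod.ext (Walk.concat_inj hconcat).1 rfl)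

theorem injected_apply (c : Configuration G) (v : V) (s : {s : V // s ∈ c.sources}) :
    c.injected v s = if v = s then 1 else 0 := by
  unfold injected
  split_ifs with hv hvs hvs
  · subst hvs
    exact Pi.single_eq_same _ _
  · exact Pi.single_eq_of_ne (fun h => hvs (congrArg Subtype.val h).symm) _
  · exact absurd (hvs ▸ s.2) hv
  · rfl

open Classical in
theorem packet_apply (hG : G.IsTree) (c : Configuration G) (ω : G.Dart → Bool)
    (s : {s : V // s ∈ c.sources}) (v : V) :
    c.packet ω v s = if c.Delivers ω s v then 1 else 0 := by
  induction v using (c.wellFounded_flow hG).induction with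
  | h v ih =>
    rw [c.packet_eq hG, Pi.add_apply, Finset.sum_apply, injected_apply]
    by_cases hv : v = s
    · subst hv
      have hno_in : (c.links.filter fun d => d.snd = (s : V) ∧ ω d = true) = ∅ :=
        filter_eq_empty_iff.2 fun d hd h => c.source_no_in d hd (h.1 ▸ s.2)
      rw [hno_in, sum_empty, add_zero, if_pos rfl, if_pos delivers_self]
    · have hin : ∀ d ∈ c.links.filter fun d => d.snd = v ∧ ω d = true,
          c.packet ω d.fst s = if c.Delivers ω s d.fst then 1 else 0 := fun d hd =>
        ih d.fst ⟨d, (mem_filter.1 hd).1, rfl, (mem_filter.1 hd).2.1⟩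
      -- On a tree at most one incoming link carries the probe of `s`, so no probe cancels.
      have huniq : ∀ d ∈ c.links.filter fun d => d.snd = v ∧ ω d = true,
          ∀ e ∈ c.links.filter fun d => d.snd = v ∧ ω d = true,
            c.Delivers ω s d.fst → c.Delivers ω s e.fst → d = e := by
        rintro d hd e he ⟨p, hp, -⟩ ⟨q, hq, -⟩
        obtain ⟨hd, hdv, -⟩ := mem_filter.1 hd
        obtain ⟨he, hev, -⟩ := mem_filter.1 he
        exact eq_of_isDirected_fst hG hd he (hdv.trans hev.symm) hp hq
      rw [sum_congr rfl hin, if_neg hv, zero_add, sum_ite_zero _ _ huniq]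
      simp only [delivers_iff_exists_last hv]

theorem packet_apply_eq_one_iff (hG : G.IsTree) {s : {s : V // s ∈ c.sources}} {p : G.Walk s v}
    (hp : c.IsDirected p) : c.packet ω v s = 1 ↔ ∀ d ∈ p.darts, ω d = true := by
  classical
  rw [c.packet_apply hG, ← hp.delivers_iff hG, ite_eq_left_iff]
  simp

theorem card_links (c : Configuration G) : #c.links = #G.edgeFinset := by
  have hcompl : c.linksᶜ = c.links.map (Dart.symm_involutive.toPerm _).toEmbedding := by
    ext d
    rw [mem_compl, mem_map_equiv, c.mem_links_iff, not_not]
    rfl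
  have hcard := card_add_card_compl c.links
  rw [hcompl, card_map, G.dart_card_eq_twice_card_edges] at hcard
  omega

theorem bandwidth_eq (hG : G.IsTree) (c : Configuration G) : c.bandwidth = #G.edgeFinset := by
  rw [bandwidth, filter_true_of_mem, card_links]
  intro d _ hzero
  obtain ⟨s, hs, p, hp⟩ := c.exists_isDirected_from_source hG d.fst
  have hone := (packet_apply_eq_one_iff hG (ω := fun _ => true) (s := ⟨s, hs⟩) hp).2 fun _ _ => rfl
  rw [hzero] at hone
  exact zero_ne_one hone

end Packet

section OutcomeDistribution

theorem pmf_eq_sum_filter (c : Configuration G) (α : G.Dart → ℝ) (x : c.Outcome) :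
    c.pmf α x = ∑ ω with c.outcome ω = x, bernoulliWeight α ω :=
  (sum_filter _ _).symm

theorem sum_pmf_filter (c : Configuration G) (α : G.Dart → ℝ) (Q : c.Outcome → Prop)
    [DecidablePred Q] :
    ∑ x with Q x, c.pmf α x = ∑ ω with Q (c.outcome ω), bernoulliWeight α ω := by
  rw [← sum_fiberwise_of_maps_to (t := {x | Q x}) (g := c.outcome) fun ω hω => by simpa using hω]
  refine sum_congr rfl fun x hx => ?_
  rw [pmf_eq_sum_filter, filter_filter]
  refine sum_congr (filter_congr fun ω _ => ?_) fun _ _ => rfl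
  rw [iff_and_self]
  rintro rfl
  simpa using hx

theorem sum_pmf_filter_of_iff {α : G.Dart → ℝ} {U : Finset G.Dart} {Q : c.Outcome → Prop}
    [DecidablePred Q] (hQ : ∀ ω, Q (c.outcome ω) ↔ ∀ d ∈ U, ω d = true) :
    ∑ x with Q x, c.pmf α x = ∏ d ∈ U, α d := by
  simp_rw [sum_pmf_filter, hQ, sum_bernoulliWeight_of_forall_mem]

theorem outcome_congr {ω ω' : G.Dart → Bool} (h : ∀ d ∈ c.links, ω d = ω' d) :
    c.outcome ω = c.outcome ω' := by
  have hop : c.nodeOperation ω = c.nodeOperation ω' := by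
    funext X v
    unfold nodeOperation
    rw [filter_congr fun d hd => by rw [h d hd]]
  unfold outcome packet
  rw [hop]

theorem pmf_update (c : Configuration G) (α : G.Dart → ℝ) {e : G.Dart} (he : e ∉ c.links)
    (t : ℝ) : c.pmf (Function.update α e t) = c.pmf α := by
  funext x
  rw [pmf_eq_sum_filter, pmf_eq_sum_filter]
  refine sum_bernoulliWeight_update (fun ω b => ?_) α t
  rw [outcome_congr fun d hd => Function.update_of_ne (ne_of_mem_of_not_mem hd he) b ω]

variable {s s' r r' : V} {α α' : G.Dart → ℝ}

theorem prodEqOn_darts_union (hG : G.IsTree) (hα : c.pmf α = c.pmf α') {p : G.Walk s r}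
    {q : G.Walk s' r'} (hp : c.IsDirected p) (hq : c.IsDirected q) (hs : s ∈ c.sources)
    (hr : r ∈ c.receivers) (hs' : s' ∈ c.sources) (hr' : r' ∈ c.receivers) :
    ProdEqOn α α' (p.darts.toFinset ∪ q.darts.toFinset) := by
  have hQ (ω : G.Dart → Bool) :
      (c.outcome ω ⟨r, hr⟩ ⟨s, hs⟩ = 1 ∧ c.outcome ω ⟨r', hr'⟩ ⟨s', hs'⟩ = 1) ↔
        ∀ d ∈ p.darts.toFinset ∪ q.darts.toFinset, ω d = true := by
    simp only [outcome, packet_apply_eq_one_iff hG (s := ⟨s, hs⟩) hp,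
      packet_apply_eq_one_iff hG (s := ⟨s', hs'⟩) hq, mem_union, List.mem_toFinset, or_imp,
      forall_and]
  have hprod (β : G.Dart → ℝ) := sum_pmf_filter_of_iff (α := β)
    (Q := fun x => x ⟨r, hr⟩ ⟨s, hs⟩ = 1 ∧ x ⟨r', hr'⟩ ⟨s', hs'⟩ = 1) hQ
  rw [ProdEqOn, ← hprod, ← hprod, hα]

theorem prodEqOn_darts (hG : G.IsTree) (hα : c.pmf α = c.pmf α') {p : G.Walk s r}
    (hp : c.IsDirected p) (hs : s ∈ c.sources) (hr : r ∈ c.receivers) :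
    ProdEqOn α α' p.darts.toFinset := by
  simpa using prodEqOn_darts_union hG hα hp hp hs hr hs hr

theorem IsDirected.disjoint_toFinset_darts (hG : G.IsTree) {p : G.Walk u v} {q : G.Walk v w}
    (hp : c.IsDirected p) (hq : c.IsDirected q) :
    Disjoint p.darts.toFinset q.darts.toFinset :=
  List.disjoint_toFinset_iff_disjoint.2
    (disjoint_darts_of_isPath_append ((isDirected_append.2 ⟨hp, hq⟩).isPath hG))

theorem prodEqOn_of_fork (hG : G.IsTree) (hα' : ∀ d, α' d ≠ 0) (hα : c.pmf α = c.pmf α')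
    {p : G.Walk s v} {q : G.Walk v r} {q' : G.Walk v r'} (hp : c.IsDirected p)
    (hq : c.IsDirected q) (hq' : c.IsDirected q') (hqq' : q.darts.Disjoint q'.darts)
    (hs : s ∈ c.sources) (hr : r ∈ c.receivers) (hr' : r' ∈ c.receivers) :
    ProdEqOn α α' p.darts.toFinset ∧ ProdEqOn α α' q.darts.toFinset := by
  have hpq := isDirected_append.2 ⟨hp, hq⟩
  have hpq' := isDirected_append.2 ⟨hp, hq'⟩
  have hprod := prodEqOn_darts hG hα hpq hs hr
  have hprod' := prodEqOn_darts hG hα hpq' hs hr'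
  have hunion := prodEqOn_darts_union hG hα hpq hpq' hs hr hs hr'
  simp only [Walk.darts_append, List.toFinset_append] at hprod hprod' hunion
  exact ProdEqOn.of_union_union hα' (hp.disjoint_toFinset_darts hG hq)
    (hp.disjoint_toFinset_darts hG hq')
    (List.disjoint_toFinset_iff_disjoint.2 hqq') hprod hprod' hunion

theorem prodEqOn_of_join (hG : G.IsTree) (hα' : ∀ d, α' d ≠ 0) (hα : c.pmf α = c.pmf α')
    {p : G.Walk s v} {p' : G.Walk s' v} {q : G.Walk v r} (hp : c.IsDirected p)
    (hp' : c.IsDirected p') (hq : c.IsDirected q) (hpp' : p.darts.Disjoint p'.darts)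
    (hs : s ∈ c.sources) (hs' : s' ∈ c.sources) (hr : r ∈ c.receivers) :
    ProdEqOn α α' p.darts.toFinset ∧ ProdEqOn α α' q.darts.toFinset := by
  have hpq := isDirected_append.2 ⟨hp, hq⟩
  have hpq' := isDirected_append.2 ⟨hp', hq⟩
  have hprod := prodEqOn_darts hG hα hpq hs hr
  have hprod' := prodEqOn_darts hG hα hpq' hs' hr
  have hunion := prodEqOn_darts_union hG hα hpq hpq' hs hr hs' hr
  simp only [Walk.darts_append, List.toFinset_append, union_comm _ q.darts.toFinset]
    at hprod hprod' hunion
  exact (ProdEqOn.of_union_union hα' (hp.disjoint_toFinset_darts hG hq).symm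
    (hp'.disjoint_toFinset_darts hG hq).symm (List.disjoint_toFinset_iff_disjoint.2 hpp')
    hprod hprod' hunion).symm

theorem exists_source_walk_concat (hG : G.IsTree) {h : G.Adj x v} (hlink : ⟨(x, v), h⟩ ∈ c.links) :
    ∃ s ∈ c.sources, ∃ p : G.Walk s x, c.IsDirected (p.concat h) := by
  obtain ⟨s, hs, p, hp⟩ := c.exists_isDirected_from_source hG x
  exact ⟨s, hs, p, isDirected_concat.2 ⟨hp, hlink⟩⟩

theorem exists_receiver_walk_cons (hG : G.IsTree) {h : G.Adj v y}
    (hlink : ⟨(v, y), h⟩ ∈ c.links) :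
    ∃ r ∈ c.receivers, ∃ q : G.Walk y r, c.IsDirected (.cons h q) := by
  obtain ⟨r, hr, q, hq⟩ := c.exists_isDirected_to_receiver hG y
  exact ⟨r, hr, q, isDirected_cons.2 ⟨hlink, hq⟩⟩

theorem exists_walks_prodEqOn (hG : G.IsTree) (hα' : ∀ d, α' d ≠ 0) (hα : c.pmf α = c.pmf α')
    (hv : 3 ≤ G.degree v) :
    (∃ s ∈ c.sources, ∃ p : G.Walk s v, c.IsDirected p ∧ ProdEqOn α α' p.darts.toFinset) ∧
      ∃ r ∈ c.receivers, ∃ q : G.Walk v r, c.IsDirected q ∧ ProdEqOn α α' q.darts.toFinset := by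
  have hleaf : v ∉ leaves G := fun h => by
    have := mem_leaves.1 h
    omega
  obtain ⟨⟨⟨x, v'⟩, hx⟩, hin, hv'⟩ := c.exists_in v hleaf
  obtain rfl : v' = v := hv'
  obtain ⟨⟨⟨v, y⟩, hy⟩, hout, hv'⟩ := c.exists_out _ hleaf
  obtain rfl : v = v' := hv'
  obtain ⟨z, hz, hzxy⟩ : ∃ z ∈ G.neighborFinset v, z ∉ ({x, y} : Finset V) := by
    refine exists_mem_notMem_of_card_lt_card (card_le_two.trans_lt ?_)
    rwa [card_neighborFinset_eq_degree]
  rw [mem_neighborFinset] at hz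
  simp only [mem_insert, mem_singleton, not_or] at hzxy
  obtain ⟨s, hs, p, hp⟩ := exists_source_walk_concat hG hin
  obtain ⟨r, hr, q, hq⟩ := exists_receiver_walk_cons hG hout
  suffices ProdEqOn α α' (p.concat hx).darts.toFinset ∧
      ProdEqOn α α' (Walk.cons hy q).darts.toFinset from
    ⟨⟨s, hs, _, hp, this.1⟩, r, hr, _, hq, this.2⟩
  rcases c.mem_links_or_symm_mem_links ⟨(v, z), hz⟩ with hlink | hlink
  · obtain ⟨r', hr', q', hq'⟩ := exists_receiver_walk_cons hG hlink
    exact prodEqOn_of_fork hG hα' hα hp hq hq'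
      (disjoint_darts_cons hG (hq.isPath hG) (hq'.isPath hG) (Ne.symm hzxy.2)) hs hr hr'
  · obtain ⟨s', hs', p', hp'⟩ := exists_source_walk_concat hG hlink
    exact prodEqOn_of_join hG hα' hα hp hp' hq
      (disjoint_darts_concat hG (hp.isPath hG) (hp'.isPath hG) (Ne.symm hzxy.1)) hs hs' hr

theorem exists_source_walk_prodEqOn (hG : G.IsTree) (hdeg : G.degree v = 1 ∨ 3 ≤ G.degree v)
    (hα' : ∀ d, α' d ≠ 0) (hα : c.pmf α = c.pmf α') (hv : v ∉ c.receivers) :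
    ∃ s ∈ c.sources, ∃ p : G.Walk s v, c.IsDirected p ∧ ProdEqOn α α' p.darts.toFinset := by
  rcases hdeg with hone | hthree
  · have hleaf : v ∈ c.sources ∪ c.receivers := c.union_eq ▸ mem_leaves.2 hone
    exact ⟨v, (mem_union.1 hleaf).resolve_right hv, .nil, isDirected_nil, prodEqOn_empty⟩
  · exact (exists_walks_prodEqOn hG hα' hα hthree).1

theorem exists_receiver_walk_prodEqOn (hG : G.IsTree)
    (hdeg : G.degree v = 1 ∨ 3 ≤ G.degree v) (hα' : ∀ d, α' d ≠ 0) (hα : c.pmf α = c.pmf α')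
    (hv : v ∉ c.sources) :
    ∃ r ∈ c.receivers, ∃ q : G.Walk v r, c.IsDirected q ∧ ProdEqOn α α' q.darts.toFinset := by
  rcases hdeg with hone | hthree
  · have hleaf : v ∈ c.sources ∪ c.receivers := c.union_eq ▸ mem_leaves.2 hone
    exact ⟨v, (mem_union.1 hleaf).resolve_left hv, .nil, isDirected_nil, prodEqOn_empty⟩
  · exact (exists_walks_prodEqOn hG hα' hα hthree).2

theorem eq_of_mem_links (hG : G.IsTree) (hdeg : ∀ v, G.degree v = 1 ∨ 3 ≤ G.degree v)
    (hα' : ∀ d, α' d ≠ 0) (hα : c.pmf α = c.pmf α') {e : G.Dart} (he : e ∈ c.links) :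
    α e = α' e := by
  obtain ⟨s, hs, p, hp, hbefore⟩ :=
    exists_source_walk_prodEqOn hG (hdeg _) hα' hα (c.receiver_no_out e he)
  obtain ⟨r, hr, q, hq, hafter⟩ :=
    exists_receiver_walk_prodEqOn hG (hdeg _) hα' hα (c.source_no_in e he)
  have heq : c.IsDirected (.cons e.adj q) := isDirected_cons.2 ⟨he, hq⟩
  have hall := prodEqOn_darts hG hα (isDirected_append.2 ⟨hp, heq⟩) hs hr
  rw [Walk.darts_append, List.toFinset_append] at hall
  have hfrom := hall.right_of_union hα' (hp.disjoint_toFinset_darts hG heq) hbefore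
  have hlink : c.IsDirected (.cons e.adj .nil) := isDirected_cons.2 ⟨he, isDirected_nil⟩
  rw [← Walk.cons_nil_append, Walk.darts_append, List.toFinset_append] at hfrom
  have honly := hfrom.left_of_union hα' (hlink.disjoint_toFinset_darts hG hq) hafter
  simpa [ProdEqOn] using honly

end OutcomeDistribution

end Configuration

variable {V : Type*} [Fintype V] [DecidableEq V] {G : SimpleGraph V} [DecidableRel G.Adj]

section Identification

variable {k : ℕ} {T : Fin k → Configuration G}

theorem exists_mem_links_of_identifies {e : G.Dart} (h : Identifies T e) :
    ∃ i, e ∈ (T i).links := by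
  by_contra! hn
  have heq := h (Function.update 1 e 2⁻¹) 1
    (fun d => by rw [Function.update_apply]; split_ifs <;> norm_num) (fun d => by simp)
    fun i => (T i).pmf_update 1 (hn i) _
  norm_num at heq

theorem identifies_iff_exists_mem_links (hG : G.IsTree)
    (hdeg : ∀ v, G.degree v = 1 ∨ 3 ≤ G.degree v) {e : G.Dart} :
    Identifies T e ↔ ∃ i, e ∈ (T i).links := by
  refine ⟨exists_mem_links_of_identifies, ?_⟩
  rintro ⟨i, he⟩ α α' - hα' hpmf
  exact Configuration.eq_of_mem_links hG hdeg (fun d => (hα' d).1.ne') (hpmf i) he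

end Identification

section Routing

variable {s₀ v : V} {S R : Finset V} {d : G.Dart}

open Classical in
/-- The orientation of the tree that routes probes to the receivers `R`. Removing an edge leaves two
components. Probes cross the edge into the component without `s₀` if that component contains
a receiver, and into the component of `s₀` otherwise. -/
noncomputable def routingLinks (G : SimpleGraph V) [DecidableRel G.Adj] (s₀ : V) (R : Finset V) :
    Finset G.Dart :=
  {d | if Toward d s₀ then ∀ r ∈ R, Toward d r else ∃ r ∈ R, Toward d r}

theorem mem_routingLinks_of_toward (h : Toward d s₀) :
    d ∈ routingLinks G s₀ R ↔ ∀ r ∈ R, Toward d r := by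
  simp [routingLinks, h]

theorem mem_routingLinks_of_not_toward (h : ¬ Toward d s₀) :
    d ∈ routingLinks G s₀ R ↔ ∃ r ∈ R, Toward d r := by
  simp [routingLinks, h]

theorem mem_routingLinks_iff_symm_notMem (hG : G.IsTree) :
    d ∈ routingLinks G s₀ R ↔ d.symm ∉ routingLinks G s₀ R := by
  by_cases h : Toward d s₀
  · have hsymm : ¬ Toward d.symm s₀ := fun hs => (toward_symm hG).1 hs h
    simp only [mem_routingLinks_of_toward h, mem_routingLinks_of_not_toward hsymm,
      toward_symm hG, not_exists, not_and, not_not]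
  · have hsymm : Toward d.symm s₀ := (toward_symm hG).2 h
    simp only [mem_routingLinks_of_not_toward h, mem_routingLinks_of_toward hsymm,
      toward_symm hG, not_forall, not_not, exists_prop]

theorem exists_toward_of_mem_routingLinks (hR : R.Nonempty) (hd : d ∈ routingLinks G s₀ R) :
    ∃ r ∈ R, Toward d r := by
  by_cases h : Toward d s₀
  · exact hR.imp fun r hr => ⟨hr, (mem_routingLinks_of_toward h).1 hd r hr⟩
  · exact (mem_routingLinks_of_not_toward h).1 hd

theorem fst_notMem_of_mem_routingLinks (hG : G.IsTree) (hR : ∀ r ∈ R, G.degree r = 1)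
    (hs₀ : s₀ ∉ R) (hd : d ∈ routingLinks G s₀ R) : d.fst ∉ R := by
  intro hr
  have htoward : Toward d s₀ :=
    toward_of_degree_fst_eq_one hG (hR _ hr) (ne_of_mem_of_not_mem hr hs₀)
  exact not_toward_fst d ((mem_routingLinks_of_toward htoward).1 hd _ hr)

theorem snd_notMem_of_mem_routingLinks (hG : G.IsTree) (hR : R.Nonempty)
    (hS : ∀ s ∈ S, G.degree s = 1) (hSR : Disjoint S R) (hd : d ∈ routingLinks G s₀ R) :
    d.snd ∉ S := by
  intro hs
  obtain ⟨r, hr, htoward⟩ := exists_toward_of_mem_routingLinks hR hd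
  exact not_toward_of_degree_snd_eq_one hG (hS _ hs) (disjoint_iff_ne.1 hSR _ hs _ hr) htoward

theorem exists_routingLinks_out (hG : G.IsTree) (hv : v ≠ s₀) (hvR : v ∉ R) :
    ∃ d ∈ routingLinks G s₀ R, d.fst = v := by
  obtain ⟨d, ⟨rfl, hd⟩, hunique⟩ := existsUnique_toward hG hv
  by_cases hall : ∀ r ∈ R, Toward d r
  · exact ⟨d, (mem_routingLinks_of_toward hd).2 hall, rfl⟩
  · push Not at hall
    obtain ⟨r, hr, hdr⟩ := hall
    obtain ⟨e, ⟨he, her⟩, -⟩ := existsUnique_toward hG (ne_of_mem_of_not_mem hr hvR).symm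
    have hes : ¬ Toward e s₀ := fun hes => hdr (hunique e ⟨he, hes⟩ ▸ her)
    exact ⟨e, (mem_routingLinks_of_not_toward hes).2 ⟨r, hr, her⟩, he⟩

theorem exists_routingLinks_in (hG : G.IsTree) (hv : v ≠ s₀) (hvR : v ∉ R)
    (hdeg : G.degree v ≠ 1) : ∃ d ∈ routingLinks G s₀ R, d.snd = v := by
  obtain ⟨d, ⟨rfl, hd⟩, hunique⟩ := existsUnique_toward hG hv
  by_cases hall : ∀ r ∈ R, Toward d r
  · obtain ⟨w, hw, hne⟩ : ∃ w ∈ G.neighborFinset d.fst, w ∉ ({d.snd} : Finset V) := by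
      refine exists_mem_notMem_of_card_lt_card ?_
      rw [card_singleton, card_neighborFinset_eq_degree]
      exact lt_of_le_of_ne d.adj.degree_pos_left hdeg.symm
    rw [mem_neighborFinset] at hw
    rw [mem_singleton] at hne
    let e : G.Dart := ⟨(d.fst, w), hw⟩
    have hed : e ≠ d := fun h => hne (congrArg (·.snd) h)
    have hes : ¬ Toward e s₀ := fun hes => hed (hunique e ⟨rfl, hes⟩)
    refine ⟨e.symm, (mem_routingLinks_of_toward ((toward_symm hG).2 hes)).2 fun r hr => ?_, rfl⟩
    refine (toward_symm hG).2 fun her => hed ?_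
    exact (existsUnique_toward hG (ne_of_mem_of_not_mem hr hvR).symm).unique ⟨rfl, her⟩
      ⟨rfl, hall r hr⟩
  · have hsymm := (mem_routingLinks_iff_symm_notMem hG).not_left.1
      (mt (mem_routingLinks_of_toward hd).1 hall)
    exact ⟨d.symm, hsymm, rfl⟩

theorem exists_configuration (hG : G.IsTree) (hS : S.Nonempty) (hR : R.Nonempty)
    (hSR : Disjoint S R) (hun : S ∪ R = leaves G) :
    ∃ c : Configuration G, c.sources = S ∧ c.receivers = R := by
  obtain ⟨s₀, hs₀⟩ := hS
  have hdegS : ∀ s ∈ S, G.degree s = 1 := fun s hs =>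
    mem_leaves.1 (hun ▸ mem_union_left R hs)
  have hdegR : ∀ r ∈ R, G.degree r = 1 := fun r hr =>
    mem_leaves.1 (hun ▸ mem_union_right S hr)
  have hs₀R : s₀ ∉ R := disjoint_left.1 hSR hs₀
  have hinner {v : V} (hv : v ∉ leaves G) : v ≠ s₀ ∧ v ∉ R := by
    rw [← hun, mem_union, not_or] at hv
    exact ⟨(ne_of_mem_of_not_mem hs₀ hv.1).symm, hv.2⟩
  exact ⟨{
    links := routingLinks G s₀ R
    sources := S
    receivers := R
    mem_links_iff := fun _ => mem_routingLinks_iff_symm_notMem hG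
    disjoint := hSR
    union_eq := hun
    source_no_in := fun _ hd => snd_notMem_of_mem_routingLinks hG hR hdegS hSR hd
    receiver_no_out := fun _ hd => fst_notMem_of_mem_routingLinks hG hdegR hs₀R hd
    exists_in := fun _ hv => exists_routingLinks_in hG (hinner hv).1 (hinner hv).2
      (mt mem_leaves.2 hv)
    exists_out := fun _ hv => exists_routingLinks_out hG (hinner hv).1 (hinner hv).2 }, rfl, rfl⟩

end Routing

section Plan

omit [DecidableEq V] in
theorem exists_mem_leaves_ne (hG : G.IsTree) [Nontrivial V] (v : V) : ∃ A ∈ leaves G, A ≠ v := by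
  obtain ⟨A, B, hAB, hA, hB⟩ := hG.exists_ne_and_degree_eq_one
  rcases eq_or_ne A v with rfl | hAv
  · exact ⟨B, mem_leaves.2 hB, hAB.symm⟩
  · exact ⟨A, mem_leaves.2 hA, hAv⟩

theorem exists_multicastTree (hG : G.IsTree) {A : V} (hA : A ∈ leaves G) :
    ∃ c : Configuration G, c.sources = {A} := by
  obtain ⟨w, hw, -⟩ := degree_eq_one_iff_existsUnique_adj.1 (mem_leaves.1 hA)
  have := nontrivial_of_ne _ _ hw.ne
  obtain ⟨B, hB, hBA⟩ := exists_mem_leaves_ne hG A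
  obtain ⟨c, hc, -⟩ := exists_configuration hG (singleton_nonempty A)
    ⟨B, mem_erase.2 ⟨hBA, hB⟩⟩ (by simp) (by rw [← insert_eq, insert_erase hA])
  exact ⟨c, hc⟩

theorem exists_mem_sources_not_toward (hG : G.IsTree) {c : Configuration G} {e : G.Dart}
    (he : e ∈ c.links) : ∃ s ∈ c.sources, ¬ Toward e s := by
  obtain ⟨s, hs, p, hp⟩ := Configuration.exists_source_walk_concat hG he
  refine ⟨s, hs, (toward_symm hG).1 ((toward_iff_exists_isPath hG).2 ⟨p.reverse, ?_⟩)⟩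
  have hrev := (hp.isPath hG).reverse
  rwa [Walk.reverse_concat] at hrev

theorem mem_links_of_not_toward (hG : G.IsTree) {c : Configuration G} {A : V}
    (hc : c.sources = {A}) {e : G.Dart} (he : ¬ Toward e A) : e ∈ c.links := by
  refine (c.mem_links_or_symm_mem_links e).resolve_right fun hsymm => ?_
  obtain ⟨s, hs, hback⟩ := exists_mem_sources_not_toward hG hsymm
  obtain rfl : s = A := by simpa [hc] using hs
  exact hback ((toward_symm hG).2 he)

omit [DecidableEq V] in
theorem exists_mem_leaves_not_toward (hG : G.IsTree) (e : G.Dart) :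
    ∃ A ∈ leaves G, ¬ Toward e A := by
  classical
  have := nontrivial_of_ne _ _ e.adj.ne
  obtain ⟨B, hB, -⟩ := exists_mem_leaves_ne hG e.fst
  obtain ⟨c, -⟩ := exists_multicastTree hG hB
  rcases c.mem_links_or_symm_mem_links e with he | he
  · obtain ⟨s, hs, hes⟩ := exists_mem_sources_not_toward hG he
    exact ⟨s, c.union_eq ▸ mem_union_left _ hs, hes⟩
  · obtain ⟨r, hr, her⟩ := exists_mem_sources_not_toward hG (Configuration.mem_dual_links.2 he)
    exact ⟨r, c.union_eq ▸ mem_union_right _ hr, her⟩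

theorem planBandwidth_eq (hG : G.IsTree) {k : ℕ} (T : Fin k → Configuration G) :
    planBandwidth T = k * #G.edgeFinset := by
  simp [planBandwidth, Configuration.bandwidth_eq hG]

theorem measuresBothDirections_pair_dual (hG : G.IsTree)
    (hdeg : ∀ v, G.degree v = 1 ∨ 3 ≤ G.degree v) (c : Configuration G) :
    MeasuresBothDirections ![c, c.dual] := fun e => by
  rw [identifies_iff_exists_mem_links hG hdeg, Fin.exists_fin_two]
  exact (c.mem_links_or_symm_mem_links e).imp id Configuration.mem_dual_links.2

theorem not_measuresBothDirections_single [Nonempty V] (c : Configuration G) :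
    ¬ MeasuresBothDirections ![c] := by
  intro h
  obtain ⟨v⟩ := ‹Nonempty V›
  obtain ⟨w, hw⟩ := (G.degree_pos_iff_exists_adj v).1 (c.degree_pos v)
  have hmem (e : G.Dart) : e ∈ c.links := by
    simpa using exists_mem_links_of_identifies (h e)
  exact (c.mem_links_iff ⟨(v, w), hw⟩).1 (hmem _) (hmem _)

theorem exists_sources_eq_singleton {k : ℕ} {T : Fin k → Configuration G}
    (hT : ∀ i, (T i).IsMulticastTree) (h : MeasuresBothDirections T) {A : V}
    (hA : A ∈ leaves G) : ∃ i, (T i).sources = {A} := by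
  obtain ⟨w, hw, -⟩ := degree_eq_one_iff_existsUnique_adj.1 (mem_leaves.1 hA)
  obtain ⟨i, hi⟩ := exists_mem_links_of_identifies (h ⟨(A, w), hw⟩)
  rw [← (T i).union_eq, mem_union] at hA
  have hsource := hA.resolve_right ((T i).receiver_no_out _ hi)
  obtain ⟨B, hB⟩ := card_eq_one.1 (hT i)
  rw [hB, mem_singleton] at hsource
  exact ⟨i, hsource ▸ hB⟩

theorem card_leaves_le {k : ℕ} {T : Fin k → Configuration G}
    (h : ∀ A ∈ leaves G, ∃ i, (T i).sources = {A}) : #(leaves G) ≤ k := by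
  rw [← card_map ⟨_, singleton_injective⟩, ← card_fin k]
  refine card_le_card_of_surjOn (fun i => (T i).sources) fun X hX => ?_
  obtain ⟨A, hA, rfl⟩ := mem_map.1 hX
  obtain ⟨i, hi⟩ := h A hA
  exact ⟨i, mem_coe.2 (mem_univ i), hi⟩

theorem exists_multicastPlan (hG : G.IsTree) (hdeg : ∀ v, G.degree v = 1 ∨ 3 ≤ G.degree v) :
    ∃ T : Fin #(leaves G) → Configuration G,
      (∀ i, (T i).IsMulticastTree) ∧ MeasuresBothDirections T := by
  choose c hc using fun A : leaves G => exists_multicastTree hG A.2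
  refine ⟨fun i => c ((leaves G).equivFin.symm i), fun i => card_eq_one.2 ⟨_, hc _⟩, fun e => ?_⟩
  obtain ⟨A, hA, he⟩ := exists_mem_leaves_not_toward hG e
  refine (identifies_iff_exists_mem_links hG hdeg).2 ⟨(leaves G).equivFin ⟨A, hA⟩, ?_⟩
  rw [Equiv.symm_apply_apply]
  exact mem_links_of_not_toward hG (hc ⟨A, hA⟩) he

end Plan

end LossTomography

theorem mainTheorem6 {V : Type*} [Fintype V] [DecidableEq V] (G : SimpleGraph V)
    [DecidableRel G.Adj] (hG : G.IsTree) (hdeg : ∀ v, G.degree v = 1 ∨ 3 ≤ G.degree v)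
    (L : ℕ) (hL : (LossTomography.leaves G).card = L) :
    -- every choice of sources and receivers among the leaves, at least one of each, can be routed
    (∀ S R : Finset V, S.Nonempty → R.Nonempty → Disjoint S R →
      S ∪ R = LossTomography.leaves G →
      ∃ c : LossTomography.Configuration G, c.sources = S ∧ c.receivers = R) ∧
    -- network coding: the configuration and its dual, one probe per link and experiment in each
    (∀ c : LossTomography.Configuration G,
      LossTomography.MeasuresBothDirections ![c, c.dual] ∧
      c.bandwidth = G.edgeFinset.card ∧ c.dual.bandwidth = G.edgeFinset.card ∧
      LossTomography.planBandwidth ![c, c.dual] = 2 * G.edgeFinset.card) ∧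
    -- one round is not enough
    (∀ c : LossTomography.Configuration G, ¬ LossTomography.MeasuresBothDirections ![c]) ∧
    -- multicast trees: each leaf has to be a root, at the cost of a factor of L
    (∀ (k : ℕ) (T : Fin k → LossTomography.Configuration G),
      (∀ i, (T i).IsMulticastTree) → LossTomography.MeasuresBothDirections T →
      (∀ A ∈ LossTomography.leaves G, ∃ i, (T i).sources = {A}) ∧ L ≤ k ∧
      ∀ c : LossTomography.Configuration G,
        L * c.bandwidth ≤ LossTomography.planBandwidth T ∧
        L * LossTomography.planBandwidth ![c, c.dual] ≤ 2 * LossTomography.planBandwidth T) ∧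
    -- and L multicast trees suffice, at exactly that cost
    (∃ T : Fin L → LossTomography.Configuration G,
      (∀ i, (T i).IsMulticastTree) ∧ LossTomography.MeasuresBothDirections T ∧
      LossTomography.planBandwidth T = L * G.edgeFinset.card ∧
      ∀ c : LossTomography.Configuration G,
        LossTomography.planBandwidth T = L * c.bandwidth ∧
        2 * LossTomography.planBandwidth T = L * LossTomography.planBandwidth ![c, c.dual]) := by
  subst hL
  have := hG.connected.nonempty
  refine ⟨fun S R => LossTomography.exists_configuration hG,
    fun c => ⟨LossTomography.measuresBothDirections_pair_dual hG hdeg c, c.bandwidth_eq hG,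
      c.dual.bandwidth_eq hG, LossTomography.planBandwidth_eq hG _⟩,
    LossTomography.not_measuresBothDirections_single, fun k T hT hmeas => ?_, ?_⟩
  · have hroot : ∀ A ∈ LossTomography.leaves G, ∃ i, (T i).sources = {A} := fun A =>
      LossTomography.exists_sources_eq_singleton hT hmeas
    have hk := LossTomography.card_leaves_le hroot
    refine ⟨hroot, hk, fun c => ?_⟩
    rw [c.bandwidth_eq hG, LossTomography.planBandwidth_eq hG, LossTomography.planBandwidth_eq hG,
      mul_left_comm]
    exact ⟨by gcongr, by gcongr⟩
  · obtain ⟨T, hT, hmeas⟩ := LossTomography.exists_multicastPlan hG hdeg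
    refine ⟨T, hT, hmeas, LossTomography.planBandwidth_eq hG T, fun c => ?_⟩
    rw [c.bandwidth_eq hG, LossTomography.planBandwidth_eq hG, LossTomography.planBandwidth_eq hG]
    exact ⟨rfl, mul_left_comm _ _ _⟩
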